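/- Let $\mathfrak n$ be a finite-dimensional complex nilpotent Lie algebra, let $l=\dim \mathfrak n/[\mathfrak n,\mathfrak n]$ and let $n\ge 0$. Let $X=\operatorname{Hom}_{\mathrm{Lie}}(\mathfrak n,\mathfrak{gl}_n(\mathbb C))$ be the affine variety of Lie algebra homomorphisms, with coordinate ring $\mathbb C[X]$ the (reduced) algebra of restrictions to $X$ of polynomial functions on the vector space $\operatorname{Hom}(\mathfrak n,\mathfrak{gl}_n(\mathbb C))$; let $GL_n(\mathbb C)$ act on $X$ by conjugation, let $X/\!\!/GL_n:=\operatorname{Spec}\bigl(\mathbb C[X]^{GL_n(\mathbb C)}\bigr)$, and let $\pi\colon X\to X/\!\!/GL_n$ be the quotient morphism. Let $S^n\mathbb C^l=(\mathbb C^l)^n/S_n=\operatorname{Spec}\bigl(\mathbb C[(\mathbb C^l)^n]^{S_n}\bigr)$. For $\rho\in X$ and $x\in\mathfrak n$ let $\rho_s(x)$ be the semisimple part of the matrix $\rho(x)$ in its Jordan decomposition. Then: 1. $X/\!\!/GL_n\cong S^n\mathbb C^l$ as schemes over $\mathbb C$. More precisely, for every basis $b_1,\dots,b_l$ of $\mathfrak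 n/[\mathfrak n,\mathfrak n]$ there is an isomorphism $S^n\mathbb C^l\to X/\!\!/GL_n$ over $\mathbb C$ that sends the class of $(v_1,\dots,v_n)\in(\mathbb C^l)^n$ to $\pi(\delta_v)$, where $\delta_v$ is the diagonal representation that sends $x$ with class $\sum_j c_jb_j$ to the diagonal matrix with entries $\sum_j c_j v_{1j},\dots,\sum_j c_jv_{nj}$. 2. For $\rho_1,\rho_2\in X$, one has $\pi(\rho_1)=\pi(\rho_2)$ if and only if there is $g\in GL_n(\mathbb C)$ with $\rho_{1,s}(x)=g\,\rho_{2,s}(x)\,g^{-1}$ for all $x\in\mathfrak n$. 3. For every $\rho\in X$ there is $g\in GL_n(\mathbb C)$ such that $g\,\rho_s(x)\,g^{-1}$ is diagonal for all $x\in\mathfrak n$. If $\pi(\rho_1)=\pi(\rho_2)$ and $g_1,g_2\in GL_n(\mathbb C)$ are such that $g_i\,\rho_{i,s}(x)\,g_i^{-1}$ is diagonal for all $x\in\mathfrak n$ and $i=1,2$, then there is a permutation $\sigma\in S_n$ such that, for all $x\in\mathfrak n$ and all $i$, the $i$-th diagonal entry of $g_1\rho_{1,s}(x)g_1^{-1}$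 is the $\sigma(i)$-th diagonal entry of $g_2\rho_{2,s}(x)g_2^{-1}$. -/

import Mathlib

open CategoryTheory AlgebraicGeometry

universe u

noncomputable section

attribute [local instance 100] LieRing.ofAssociativeRing

/-! ### Affine schemes over the complex numbers -/

/-- The affine `ℂ`-scheme `Spec A` of a commutative `ℂ`-algebra `A`, as a scheme over `Spec ℂ`.
(The ring `ULift ℂ` is `ℂ`, placed in the universe of `A`.) -/
def complexSpec (A : Type u) [CommRing A] [Algebra ℂ A] :
    Over (Spec (CommRingCat.of (ULift.{u} ℂ))) :=
  Over.mk (Y := Spec (CommRingCat.of A)) (Spec.map (CommRingCat.ofHom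
    ((algebraMap ℂ A).comp (ULift.ringEquiv (R := ℂ)).toRingHom)))

/-- The morphism `Spec B ⟶ Spec A` over `ℂ` given by a homomorphism `A → B` of `ℂ`-algebras. -/
def complexSpecMap {A B : Type u} [CommRing A] [Algebra ℂ A] [CommRing B] [Algebra ℂ B]
    (φ : A →ₐ[ℂ] B) : complexSpec B ⟶ complexSpec A :=
  Over.homMk (U := complexSpec B) (V := complexSpec A) (Spec.map (CommRingCat.ofHom φ.toRingHom))
    (by
      change Spec.map _ ≫ Spec.map _ = Spec.map _
      rw [← Spec.map_comp, ← CommRingCat.ofHom_comp]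
      congr 2
      ext x
      exact φ.commutes _)

/-- The point of `Spec A` given by a `ℂ`-algebra homomorphism `A → ℂ`: its kernel. -/
def complexPoint {A : Type u} [CommRing A] [Algebra ℂ A] (φ : A →ₐ[ℂ] ℂ) :
    ((complexSpec A).left : Scheme) :=
  (⟨RingHom.ker φ, RingHom.ker_isPrime φ⟩ : PrimeSpectrum A)

/-! ### The symmetric product `S^n ℂ^l = (ℂ^l)^n / S_n` -/

/-- The ring of invariants of the symmetric group `S_n` permuting the `n` factors of `(ℂ^l)^n`;
the variable `X (i, j)` is the `j`-th coordinate on the `i`-th factor. -/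
def multisymmetric (n l : ℕ) : Subalgebra ℂ (MvPolynomial (Fin n × Fin l) ℂ) where
  carrier := {p | ∀ σ : Equiv.Perm (Fin n), MvPolynomial.rename (Prod.map σ id) p = p}
  mul_mem' := fun ha hb σ => by rw [map_mul, ha σ, hb σ]
  add_mem' := fun ha hb σ => by rw [map_add, ha σ, hb σ]
  algebraMap_mem' := fun r σ => AlgHom.commutes _ r

/-- The affine scheme `(ℂ^l)^n`. -/
def tupleScheme (n l : ℕ) : Over (Spec (CommRingCat.of (ULift.{u} ℂ))) :=
  complexSpec (ULift.{u} (MvPolynomial (Fin n × Fin l) ℂ))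

/-- The symmetric product `S^n ℂ^l = (ℂ^l)^n / S_n`, the spectrum of the `S_n`-invariant
polynomials on `(ℂ^l)^n`. -/
def symProduct (n l : ℕ) : Over (Spec (CommRingCat.of (ULift.{u} ℂ))) :=
  complexSpec (ULift.{u} (multisymmetric n l))

/-- The quotient morphism `(ℂ^l)^n ⟶ S^n ℂ^l`. -/
def symProductMap (n l : ℕ) : tupleScheme.{u} n l ⟶ symProduct.{u} n l :=
  complexSpecMap (((ULift.algEquiv (R := ℂ)).symm.toAlgHom.comp (multisymmetric n l).val).comp
    (ULift.algEquiv (R := ℂ)).toAlgHom)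

/-- The point of the scheme `(ℂ^l)^n` given by a tuple `v = (v_1, …, v_n)` of vectors in `ℂ^l`. -/
def tuplePoint {n l : ℕ} (v : Fin n → Fin l → ℂ) : ((tupleScheme.{u} n l).left : Scheme) :=
  complexPoint ((MvPolynomial.aeval fun p : Fin n × Fin l => v p.1 p.2).comp
    (ULift.algEquiv (R := ℂ)).toAlgHom)

/-! ### The space of representations and its categorical quotient -/

section Representations

variable (𝔫 : Type u) [LieRing 𝔫] [LieAlgebra ℂ 𝔫] (n : ℕ)

/-- The set of Lie algebra homomorphisms from `𝔫` to `𝔤𝔩_n(ℂ)`, the Lie algebra of all complex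
`n × n` matrices with the commutator bracket. -/
abbrev LieRep : Type u := 𝔫 →ₗ⁅ℂ⁆ Matrix (Fin n) (Fin n) ℂ

/-- The algebra of regular functions on `Hom_Lie(𝔫, 𝔤𝔩_n)`, for `𝔫` of finite dimension: the
functions that are polynomials in the matrix entries `ρ ↦ ρ(x)_{ij}`, that is, the restrictions of
the polynomial functions on the vector space `Hom(𝔫, 𝔤𝔩_n)`. -/
def repFunctions : Subalgebra ℂ (LieRep 𝔫 n → ℂ) :=
  Algebra.adjoin ℂ
    (Set.range fun (p : 𝔫 × Fin n × Fin n) (ρ : LieRep 𝔫 n) => ρ p.1 p.2.1 p.2.2)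

variable {𝔫 n} in
/-- The conjugate `x ↦ g ρ(x) g⁻¹` of a representation by `g ∈ GL_n(ℂ)`. -/
def conjRep (g : GL (Fin n) ℂ) (ρ : LieRep 𝔫 n) : LieRep 𝔫 n where
  toFun x := (g : Matrix (Fin n) (Fin n) ℂ) * ρ x * (↑g⁻¹ : Matrix (Fin n) (Fin n) ℂ)
  map_add' x y := by rw [map_add, mul_add, add_mul]
  map_smul' c x := by simp
  map_lie' {x y} := by
    have h : (↑g⁻¹ : Matrix (Fin n) (Fin n) ℂ) * (g : Matrix (Fin n) (Fin n) ℂ) = 1 := by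
      rw [← Units.val_mul, inv_mul_cancel, Units.val_one]
    have key : ∀ A B : Matrix (Fin n) (Fin n) ℂ,
        (g : Matrix (Fin n) (Fin n) ℂ) * (A * B) * (↑g⁻¹ : Matrix (Fin n) (Fin n) ℂ) =
        ((g : Matrix (Fin n) (Fin n) ℂ) * A * (↑g⁻¹ : Matrix (Fin n) (Fin n) ℂ)) *
        ((g : Matrix (Fin n) (Fin n) ℂ) * B * (↑g⁻¹ : Matrix (Fin n) (Fin n) ℂ)) := by
      intro A B
      calc _ = (g : Matrix (Fin n) (Fin n) ℂ) * A * 1 * B *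
              (↑g⁻¹ : Matrix (Fin n) (Fin n) ℂ) := by simp only [mul_assoc, one_mul]
        _ = _ := by rw [← h]; simp only [mul_assoc]
    simp only [LieHom.map_lie, Ring.lie_def, mul_sub, sub_mul, key]

/-- The algebra of `GL_n(ℂ)`-invariant regular functions on `Hom_Lie(𝔫, 𝔤𝔩_n)`. -/
def repInvariants : Subalgebra ℂ (repFunctions 𝔫 n) where
  carrier := {f | ∀ (g : GL (Fin n) ℂ) (ρ : LieRep 𝔫 n), f.1 (conjRep g ρ) = f.1 ρ}
  mul_mem' {a b} ha hb g ρ := by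
    change a.1 _ * b.1 _ = a.1 _ * b.1 _
    rw [ha g ρ, hb g ρ]
  add_mem' {a b} ha hb g ρ := by
    change a.1 _ + b.1 _ = a.1 _ + b.1 _
    rw [ha g ρ, hb g ρ]
  algebraMap_mem' _ _ _ := rfl

/-- The affine variety `Hom_Lie(𝔫, 𝔤𝔩_n)`, as a (reduced) scheme over `ℂ`. -/
def repScheme : Over (Spec (CommRingCat.of (ULift.{u} ℂ))) :=
  complexSpec (repFunctions 𝔫 n)

/-- The categorical quotient `Hom_Lie(𝔫, 𝔤𝔩_n) // GL_n`, the spectrum of the algebra of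
`GL_n(ℂ)`-invariant regular functions. -/
def repQuotient : Over (Spec (CommRingCat.of (ULift.{u} ℂ))) :=
  complexSpec (repInvariants 𝔫 n)

/-- The quotient morphism `Hom_Lie(𝔫, 𝔤𝔩_n) ⟶ Hom_Lie(𝔫, 𝔤𝔩_n) // GL_n`. -/
def repQuotientMap : repScheme 𝔫 n ⟶ repQuotient 𝔫 n :=
  complexSpecMap (repInvariants 𝔫 n).val

variable {𝔫 n}

/-- A representation as a point of the scheme `Hom_Lie(𝔫, 𝔤𝔩_n)`. -/
def repPoint (ρ : LieRep 𝔫 n) : ((repScheme 𝔫 n).left : Scheme) :=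
  complexPoint ((Pi.evalAlgHom ℂ (fun _ : LieRep 𝔫 n => ℂ) ρ).comp (repFunctions 𝔫 n).val)

variable (𝔫) in
/-- The abelianization `𝔫 / [𝔫, 𝔫]`. -/
abbrev LieAbelianization : Type u := 𝔫 ⧸ ⁅(⊤ : LieIdeal ℂ 𝔫), (⊤ : LieIdeal ℂ 𝔫)⁆

/-- The diagonal representation with joint eigenvalues `v_1, …, v_n ∈ ℂ^l`, for a basis
`b_1, …, b_l` of `𝔫 / [𝔫, 𝔫]`: it sends an element with class `∑ j, c_j b_j` to the diagonal matrix
whose `i`-th diagonal entry is `∑ j, c_j v_{ij}`. -/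
def diagRep {l : ℕ} (b : Module.Basis (Fin l) ℂ (LieAbelianization 𝔫)) (v : Fin n → Fin l → ℂ) :
    LieRep 𝔫 n where
  toFun x := Matrix.diagonal fun i =>
    ∑ j, b.repr (LieSubmodule.Quotient.mk x : LieAbelianization 𝔫) j * v i j
  map_add' x y := by
    rw [Matrix.diagonal_add]
    congr 1
    funext i
    rw [← Finset.sum_add_distrib]
    refine Finset.sum_congr rfl fun j _ => ?_
    rw [← add_mul]
    congr 1
    exact congrArg (fun t => t j) (map_add b.repr (LieSubmodule.Quotient.mk x)
      (LieSubmodule.Quotient.mk y))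
  map_smul' c x := by
    rw [← Matrix.diagonal_smul]
    congr 1
    funext i
    simp only [Pi.smul_apply, smul_eq_mul, RingHom.id_apply, Finset.mul_sum, ← mul_assoc]
    refine Finset.sum_congr rfl fun j _ => ?_
    congr 1
    exact congrArg (fun t => t j) (map_smul b.repr c (LieSubmodule.Quotient.mk x))
  map_lie' {x y} := by
    have h : (LieSubmodule.Quotient.mk ⁅x, y⁆ : LieAbelianization 𝔫) = 0 :=
      (LieSubmodule.Quotient.mk_eq_zero' (N := ⁅(⊤ : LieIdeal ℂ 𝔫), (⊤ : LieIdeal ℂ 𝔫)⁆)).2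
        (LieSubmodule.lie_mem_lie (LieSubmodule.mem_top x) (LieSubmodule.mem_top y))
    rw [h, Ring.lie_def, Matrix.diagonal_mul_diagonal, Matrix.diagonal_mul_diagonal]
    simp [mul_comm]

end Representations

/-! ### Semisimple parts of matrices -/

/-- Existence of the Jordan decomposition of a complex matrix. -/
theorem exists_semisimple_part {n : ℕ} (A : Matrix (Fin n) (Fin n) ℂ) :
    ∃ S : Matrix (Fin n) (Fin n) ℂ, Module.End.IsSemisimple (Matrix.toLin' S) ∧
      IsNilpotent (A - S) ∧ Commute A S := by
  obtain ⟨N, hN, S, hS, hnil, hss, h⟩ :=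
    Module.End.exists_isNilpotent_isSemisimple (f := Matrix.toLin' A)
  have hc : Commute (Matrix.toLin' A) S :=
    (Algebra.commute_of_mem_adjoin_singleton_of_commute hS (Commute.refl _))
  refine ⟨LinearMap.toMatrixAlgEquiv' S, ?_, ?_, ?_⟩
  · exact (Matrix.toLin'_toMatrix' S).symm ▸ hss
  · have : A - LinearMap.toMatrixAlgEquiv' S = LinearMap.toMatrixAlgEquiv' N := by
      have hA : A = LinearMap.toMatrixAlgEquiv' (Matrix.toLin' A) :=
        (LinearMap.toMatrix'_toLin' A).symm
      rw [hA, h, map_add, add_sub_cancel_right]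
    rw [this]
    exact hnil.map _
  · have := hc.map (LinearMap.toMatrixAlgEquiv' (R := ℂ) (n := Fin n))
    rwa [show LinearMap.toMatrixAlgEquiv' (Matrix.toLin' A) = A from
      LinearMap.toMatrix'_toLin' A] at this

/-- The semisimple part `A_s` of the Jordan decomposition `A = A_s + A_n` of a complex matrix: the
unique semisimple matrix that commutes with `A` and differs from it by a nilpotent matrix. -/
def semisimplePart {n : ℕ} (A : Matrix (Fin n) (Fin n) ℂ) : Matrix (Fin n) (Fin n) ℂ :=
  (exists_semisimple_part A).choose

theorem semisimplePart_spec {n : ℕ} (A : Matrix (Fin n) (Fin n) ℂ) :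
    Module.End.IsSemisimple (Matrix.toLin' (semisimplePart A)) ∧
      IsNilpotent (A - semisimplePart A) ∧ Commute A (semisimplePart A) :=
  (exists_semisimple_part A).choose_spec

theorem eq_semisimplePart {n : ℕ} {A S : Matrix (Fin n) (Fin n) ℂ}
    (hS : Module.End.IsSemisimple (Matrix.toLin' S)) (hN : IsNilpotent (A - S))
    (hc : Commute A S) : S = semisimplePart A := by
  obtain ⟨hS', hN', hc'⟩ := semisimplePart_spec A
  have key := Module.End.isNilpotent_isSemisimple_unique
    (hN.map (Matrix.toLinAlgEquiv' (R := ℂ) (n := Fin n))) hS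
    (hN'.map (Matrix.toLinAlgEquiv' (R := ℂ) (n := Fin n))) hS'
    ((hc.sub_left (Commute.refl S)).map (Matrix.toLinAlgEquiv' (R := ℂ) (n := Fin n)))
    ((hc'.sub_left (Commute.refl _)).map (Matrix.toLinAlgEquiv' (R := ℂ) (n := Fin n)))
    (by
      change Matrix.toLin' (A - S) + Matrix.toLin' S =
        Matrix.toLin' (A - semisimplePart A) + Matrix.toLin' (semisimplePart A)
      rw [← map_add, ← map_add, sub_add_cancel, sub_add_cancel])
  exact Matrix.toLin'.injective key.2

end

/-! By Lie's theorem every `ρ` is conjugate to a lower triangular representation. Conjugation by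
`diag(t^i)` followed by `t → 0` degenerates it to its diagonal part, and an invariant function is
continuous and constant along the way. So invariants are determined by their values on diagonal
representations (`exists_forall_invariant_eq_diagRep`). These factor through the abelianization and
form a copy of `(ℂ^l)^n`, on which permutation matrices act as `S_n`. Restriction thus embeds the
invariants into the multisymmetric polynomials. It is onto because the symmetrization of a monomial
is a permanent, and Ryser's formula writes it through determinants of equivariant matrices
(`exists_invariant_diagRep_eq_sum_perm`).

For the fibres, `π(ρ)` is equivalent to the family of characteristic polynomials of all `ρ(x)`.
These are invariant. Conversely, they fix the diagonal entries up to a permutation depending on `x`;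
since the entries are linear in `x`, one permutation serves all `x`
(`exists_perm_of_forall_exists_perm`).

Nilpotency gives a decomposition into generalized weight spaces. On each of them the semisimple part
of `ρ(x)` is the scalar given by a linear weight, so all semisimple parts are diagonalized at once.
As `A` and its semisimple part share a characteristic polynomial, the same permutation argument
yields the remaining claims. -/

noncomputable section

attribute [local instance 100] LieRing.ofAssociativeRing

/-! ### Matching families up to a permutation -/

/-- Two families of linear functionals which agree pointwise up to permutation agree up to a
single permutation. -/
theorem exists_perm_of_forall_exists_perm {K V ι : Type*} [Field K] [Infinite K] [AddCommGroup V]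
    [Module K V] [Fintype ι] [DecidableEq ι] (α β : ι → V →ₗ[K] K)
    (h : ∀ x, ∃ σ : Equiv.Perm ι, ∀ i, α i x = β (σ i) x) :
    ∃ σ : Equiv.Perm ι, ∀ x i, α i x = β (σ i) x := by
  classical
  let W : Equiv.Perm ι → Submodule K V := fun σ => ⨅ i, LinearMap.ker (α i - β (σ i))
  have hW : ∀ σ x, x ∈ W σ ↔ ∀ i, α i x = β (σ i) x := by
    intro σ x
    simp [W, sub_eq_zero]
  by_contra! hne
  -- A vector space over an infinite field is not a finite union of proper subspaces, and the `W σ`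
  -- cover `V`.
  refine Subspace.biUnion_ne_univ_of_top_notMem (k := K) (E := V)
    (s := Finset.univ.image W) ?_ ?_
  · intro ht
    obtain ⟨σ, -, hσ⟩ := Finset.mem_image.1 ht
    obtain ⟨x, i, hx⟩ := hne σ
    exact hx ((hW σ x).1 (hσ ▸ Submodule.mem_top) i)
  · refine Set.eq_univ_of_forall fun x => ?_
    obtain ⟨σ, hσ⟩ := h x
    exact Set.mem_biUnion (Finset.mem_image_of_mem W (Finset.mem_univ σ)) ((hW σ x).2 hσ)

/-- Families with the same monic polynomial of roots agree up to permutation. -/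
theorem exists_perm_of_prod_X_sub_C_eq {K ι : Type*} [Field K] [Fintype ι] (a b : ι → K)
    (h : ∏ i, (Polynomial.X - Polynomial.C (a i)) = ∏ i, (Polynomial.X - Polynomial.C (b i))) :
    ∃ σ : Equiv.Perm ι, ∀ i, a i = b (σ i) := by
  classical
  have hm : Finset.univ.val.map a = Finset.univ.val.map b := by
    have key : ∀ c : ι → K, (∏ i, (Polynomial.X - Polynomial.C (c i))).roots =
        Finset.univ.val.map c := by
      intro c
      rw [← Polynomial.roots_multiset_prod_X_sub_C (Finset.univ.val.map c), Multiset.map_map]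
      rfl
    rw [← key, ← key, h]
  -- Equal root multisets mean fibres of equal size; bijections between the fibres glue to `σ`.
  have hcard : ∀ c, Fintype.card {i // a i = c} = Fintype.card {i // b i = c} := by
    intro c
    have := congrArg (Multiset.count c) hm
    rw [Multiset.count_map, Multiset.count_map] at this
    rw [Fintype.card_subtype, Fintype.card_subtype]
    simpa [Finset.card, eq_comm] using this
  have e : ∀ c, {i // a i = c} ≃ {i // b i = c} := fun c => Fintype.equivOfCardEq (hcard c)
  refine ⟨(Equiv.sigmaFiberEquiv a).symm.trans
    ((Equiv.sigmaCongrRight e).trans (Equiv.sigmaFiberEquiv b)), fun i => ?_⟩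
  exact ((e (a i)) ⟨i, rfl⟩).2.symm

/-! ### Characteristic polynomials and Jordan decomposition -/

theorem det_one_sub_of_isNilpotent {n : ℕ} {M : Matrix (Fin n) (Fin n) ℂ} (hM : IsNilpotent M) :
    (1 - M).det = 1 := by
  have h := Matrix.isNilpotent_charpoly_sub_pow_of_isNilpotent hM
  have h' : M.charpoly = Polynomial.X ^ n := by
    simpa [sub_eq_zero] using h.eq_zero
  have := Matrix.eval_charpoly M 1
  rw [h'] at this
  simpa using this.symm

/-- For `t` outside the finite spectrum of `S`, the matrix `U = t - S` is invertible and `t - A = U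
(1 - U⁻¹(A - S))`. The second factor is unipotent by commutation, so both determinants agree at
infinitely many `t`. -/
theorem charpoly_eq_of_commute_of_isNilpotent_sub {n : ℕ} {A S : Matrix (Fin n) (Fin n) ℂ}
    (hc : Commute A S) (hN : IsNilpotent (A - S)) : A.charpoly = S.charpoly := by
  refine Polynomial.eq_of_infinite_eval_eq _ _ ?_
  refine Set.Infinite.mono ?_ (Set.Finite.infinite_compl (α := ℂ)
    (Polynomial.finite_setOfPred_isRoot S.charpoly_monic.ne_zero))
  · intro t ht
    have ht' : S.charpoly.eval t ≠ 0 := ht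
    rw [Matrix.eval_charpoly] at ht'
    change A.charpoly.eval t = S.charpoly.eval t
    rw [Matrix.eval_charpoly, Matrix.eval_charpoly]
    obtain ⟨U, hU⟩ : ∃ U, U = Matrix.scalar (Fin n) t - S := ⟨_, rfl⟩
    rw [← hU] at ht' ⊢
    have hu : IsUnit U.det := isUnit_iff_ne_zero.2 ht'
    have hcU : Commute U (A - S) := by
      rw [hU]
      refine Commute.sub_left ?_ ?_
      · exact Matrix.scalar_commute t (fun r => Commute.all t r) _
      · exact (hc.sub_left (Commute.refl S)).symm
    have hcU' : Commute U⁻¹ (A - S) := by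
      obtain ⟨u, rfl⟩ := (Matrix.isUnit_iff_isUnit_det U).2 hu
      rw [← Matrix.coe_units_inv]
      exact Commute.units_inv_left hcU
    have hfac : Matrix.scalar (Fin n) t - A = U * (1 - U⁻¹ * (A - S)) := by
      rw [mul_sub, mul_one, ← mul_assoc, Matrix.mul_nonsing_inv _ hu, one_mul, hU]
      abel
    rw [hfac, Matrix.det_mul, det_one_sub_of_isNilpotent (hcU'.isNilpotent_mul_left hN), mul_one]

theorem charpoly_semisimplePart {n : ℕ} (A : Matrix (Fin n) (Fin n) ℂ) :
    (semisimplePart A).charpoly = A.charpoly :=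
  (charpoly_eq_of_commute_of_isNilpotent_sub (semisimplePart_spec A).2.2
    (semisimplePart_spec A).2.1).symm

/-! ### Bases and Lie's theorem -/

/-- The change of coordinates attached to a basis of `ℂ^n`. -/
theorem exists_conj_apply_eq_repr {n : ℕ} (b : Module.Basis (Fin n) ℂ (Fin n → ℂ)) :
    ∃ g : GL (Fin n) ℂ, ∀ (A : Matrix (Fin n) (Fin n) ℂ) (i j : Fin n),
      (g.1 * A * g⁻¹.1) i j = b.repr (A.mulVec (b j)) i := by
  let c := Pi.basisFun ℂ (Fin n)
  refine ⟨⟨b.toMatrix c, c.toMatrix b, b.toMatrix_mul_toMatrix_flip c,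
    c.toMatrix_mul_toMatrix_flip b⟩, fun A i j => ?_⟩
  change (b.toMatrix c * A * c.toMatrix b) i j = _
  have hA : A = LinearMap.toMatrix c c (Matrix.toLin' A) := by
    rw [LinearMap.toMatrix_eq_toMatrix', LinearMap.toMatrix'_toLin']
  rw [hA, basis_toMatrix_mul_linearMap_toMatrix_mul_basis_toMatrix, LinearMap.toMatrix_apply,
    ← hA, Matrix.toLin'_apply]

/-- **Lie's theorem**: a basis in which a solvable Lie algebra acts by lower triangular
matrices. -/
theorem exists_basis_forall_repr_eq_zero {L : Type*} [LieRing L] [LieAlgebra ℂ L]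
    [FiniteDimensional ℂ L] [LieAlgebra.IsSolvable L] (n : ℕ) :
    ∀ (V : Type) [AddCommGroup V] [Module ℂ V] [LieRingModule L V] [LieModule ℂ L V]
      [FiniteDimensional ℂ V], Module.finrank ℂ V = n →
      ∃ b : Module.Basis (Fin n) ℂ V, ∀ (x : L) i j, i < j → b.repr ⁅x, b j⁆ i = 0 := by
  induction n with
  | zero =>
    intro V _ _ _ _ _ h
    exact ⟨(Module.finBasis ℂ V).reindex (finCongr h), fun _ i => i.elim0⟩
  | succ n ih =>
    intro V _ _ _ _ _ h
    have : Nontrivial V := Module.nontrivial_of_finrank_pos (R := ℂ) (by omega)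
    -- A common eigenvector `φ` in the dual has an invariant hyperplane as kernel. Induction applies
    -- to the kernel, and a complementary vector `y` placed first in the basis makes the matrices
    -- lower triangular.
    obtain ⟨χ, hχ⟩ := LieModule.exists_nontrivial_weightSpace_of_isSolvable ℂ L (V →ₗ[ℂ] ℂ)
    obtain ⟨⟨φ, hφ⟩, hφ0⟩ := exists_ne (0 : LieModule.weightSpace (V →ₗ[ℂ] ℂ) χ)
    rw [LieModule.mem_weightSpace] at hφ
    have hφ0 : φ ≠ 0 := fun h => hφ0 (Subtype.ext h)
    have key : ∀ x v, φ ⁅x, v⁆ = - (χ x * φ v) := by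
      intro x v
      have := congrArg (fun f : V →ₗ[ℂ] ℂ => f v) (hφ x)
      simp only [Module.Dual.lie_apply, LinearMap.smul_apply, smul_eq_mul] at this
      rw [← this, neg_neg]
    let N : LieSubmodule ℂ L V :=
      { LinearMap.ker φ with
        lie_mem := by
          intro x v hv
          have hv : φ v = 0 := hv
          change φ ⁅x, v⁆ = 0
          rw [key, hv, mul_zero, neg_zero] }
    have hN : Module.finrank ℂ N = n := by
      have h1 := LinearMap.finrank_range_add_finrank_ker φ
      rw [LinearMap.range_eq_top.2 (LinearMap.surjective hφ0), finrank_top,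
        Module.finrank_self] at h1
      have : Module.finrank ℂ N = Module.finrank ℂ (LinearMap.ker φ) := rfl
      omega
    obtain ⟨b, hb⟩ := ih N hN
    obtain ⟨y, hy⟩ := LinearMap.surjective hφ0 1
    let b' : Module.Basis (Fin n) ℂ (LinearMap.ker φ) := b
    let c : Module.Basis (Fin (n + 1)) ℂ V := Module.Basis.mkFinCons y b'
      (by
        intro a x hx h0
        have := congrArg φ h0
        rw [map_add, map_smul, hy, LinearMap.mem_ker.1 hx] at this
        simpa using this)
      (by
        intro z
        refine ⟨-φ z, ?_⟩
        rw [LinearMap.mem_ker, map_add, map_smul, hy]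
        simp)
    have hc : ⇑c = Fin.cons y (fun i => ((b i : N) : V)) :=
      Module.Basis.coe_mkFinCons _ _ _ _
    have hcs : ∀ i : Fin n, c i.succ = (b i : V) := fun i => by rw [hc, Fin.cons_succ]
    have hrep : ∀ v : N, c.repr (v : V) = Finsupp.mapDomain Fin.succ (b.repr v) := by
      intro v
      have hv : (v : V) = ∑ i, b.repr v i • c i.succ := by
        have := congrArg N.toSubmodule.subtype (b.sum_repr v)
        rw [map_sum] at this
        simp only [hcs]
        exact this.symm
      rw [hv]
      simp only [map_sum, map_smul, Module.Basis.repr_self]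
      ext k
      refine Fin.cases ?_ (fun k => ?_) k
      · rw [Finsupp.mapDomain_of_notMem_range _ _ (by simp)]
        simp [Finsupp.finsetSum_apply]
      · rw [Finsupp.mapDomain_apply (Fin.succ_injective n)]
        simp [Finsupp.finsetSum_apply, Finsupp.single_apply]
    refine ⟨c, fun x i j => ?_⟩
    refine Fin.cases (fun hlt => absurd hlt (Fin.not_lt_zero _)) (fun j hlt => ?_) j
    rw [hcs, show ⁅x, (b j : V)⁆ = ((⁅x, b j⁆ : N) : V) from rfl, hrep]
    refine Fin.cases (fun _ => ?_) (fun i hlt => ?_) i hlt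
    · rw [Finsupp.mapDomain_of_notMem_range _ _ (by simp)]
    · rw [Finsupp.mapDomain_apply (Fin.succ_injective n)]
      exact hb x i j (Fin.succ_lt_succ_iff.1 hlt)

/-! ### Simultaneous diagonalization of the semisimple parts -/

/-- The product of `X - a` over the distinct eigenvalues `a` is squarefree and annihilates `T`;
taking the image of `d` removes repetitions. -/
theorem isSemisimple_of_basis_eigenvectors {K V ι : Type*} [Field K] [AddCommGroup V] [Module K V]
    [Finite ι] (c : Module.Basis ι K V) (d : ι → K) (T : Module.End K V)
    (h : ∀ i, T (c i) = d i • c i) : T.IsSemisimple := by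
  classical
  have := Fintype.ofFinite ι
  refine Module.End.isSemisimple_of_squarefree_aeval_eq_zero
    (p := ∏ a ∈ Finset.univ.image d, (Polynomial.X - Polynomial.C a)) ?_ ?_
  · refine (Polynomial.separable_prod_X_sub_C_iff' (f := fun a : K => a)).2 ?_ |>.squarefree
    intro a _ b _ hab
    exact hab
  · refine c.ext fun i => ?_
    have hi : d i ∈ Finset.univ.image d := Finset.mem_image_of_mem d (Finset.mem_univ i)
    rw [← Finset.prod_erase_mul _ _ hi, map_mul, Module.End.mul_apply]
    simp [h]

theorem isNilpotent_of_basis {K V ι : Type*} [Field K] [AddCommGroup V] [Module K V]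
    [FiniteDimensional K V] (c : Module.Basis ι K V) (T : Module.End K V)
    (h : ∀ i, ∃ k : ℕ, (T ^ k) (c i) = 0) : IsNilpotent T := by
  rw [Module.End.isNilpotent_iff_of_finite]
  have hmem : ∀ v, v ∈ T.maxGenEigenspace 0 ↔ ∃ k : ℕ, (T ^ k) v = 0 := by
    intro v
    rw [Module.End.mem_maxGenEigenspace, zero_smul, sub_zero]
  intro v
  rw [← hmem]
  have htop : T.maxGenEigenspace 0 = ⊤ := by
    rw [eq_top_iff, ← c.span_eq, Submodule.span_le]
    rintro _ ⟨i, rfl⟩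
    exact (hmem _).2 (h i)
  rw [htop]
  exact Submodule.mem_top

/-- A basis adapted to the decomposition into generalized weight spaces. -/
theorem exists_basis_mem_genWeightSpace {L V : Type*} [LieRing L] [LieAlgebra ℂ L]
    [LieRing.IsNilpotent L] [AddCommGroup V] [Module ℂ V] [LieRingModule L V] [LieModule ℂ L V]
    [FiniteDimensional ℂ V] {n : ℕ} (hn : Module.finrank ℂ V = n) :
    ∃ (c : Module.Basis (Fin n) ℂ V) (χ : Fin n → LieModule.Weight ℂ L V),
      (∀ i, c i ∈ LieModule.genWeightSpace V (χ i)) ∧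
      ∀ i, ∀ v ∈ LieModule.genWeightSpace V (χ i), ∀ j, c.repr v j ≠ 0 → χ j = χ i := by
  classical
  have hint : DirectSum.IsInternal fun χ : LieModule.Weight ℂ L V =>
      (LieModule.genWeightSpace V χ).toSubmodule := by
    refine DirectSum.isInternal_submodule_of_iSupIndep_of_iSup_eq_top ?_ ?_
    · exact LieSubmodule.iSupIndep_toSubmodule.2 (LieModule.iSupIndep_genWeightSpace' ℂ L V)
    · rw [← LieSubmodule.iSup_toSubmodule, LieModule.iSup_genWeightSpace_eq_top',
        LieSubmodule.top_toSubmodule]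
  let w := fun χ : LieModule.Weight ℂ L V =>
    Module.finBasis ℂ (LieModule.genWeightSpace V χ).toSubmodule
  let c := hint.collectedBasis w
  have : Fintype (LieModule.Weight ℂ L V) := Fintype.ofFinite _
  let e := Fintype.equivFinOfCardEq ((Module.finrank_eq_card_basis c).symm.trans hn)
  refine ⟨c.reindex e, fun i => (e.symm i).1, fun i => ?_, fun i v hv j hj => ?_⟩
  · rw [Module.Basis.reindex_apply]
    exact hint.collectedBasis_mem w _
  · by_contra hne
    refine hj ?_
    rw [Module.Basis.repr_reindex_apply]
    exact hint.collectedBasis_repr_of_mem_ne w (Ne.symm hne) hv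

/-- The semisimple parts of a representation of a nilpotent Lie algebra are simultaneously
diagonalizable, and the diagonal entries are linear functionals. -/
theorem exists_conj_semisimplePart_eq_diagonal {L : Type*} [LieRing L] [LieAlgebra ℂ L]
    [LieRing.IsNilpotent L] {n : ℕ} (ρ : L →ₗ⁅ℂ⁆ Matrix (Fin n) (Fin n) ℂ) :
    ∃ (g : GL (Fin n) ℂ) (μ : Fin n → L →ₗ[ℂ] ℂ), ∀ x,
      g.1 * semisimplePart (ρ x) * g⁻¹.1 = Matrix.diagonal fun i => μ i x := by
  let : LieRingModule L (Fin n → ℂ) := LieRingModule.compLieHom (Fin n → ℂ) ρ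
  let : LieModule ℂ L (Fin n → ℂ) := LieModule.compLieHom (Fin n → ℂ) ρ
  obtain ⟨c, χ, hc, hχ⟩ := exists_basis_mem_genWeightSpace (L := L) (V := Fin n → ℂ) (n := n)
    (by simp)
  obtain ⟨g, hg⟩ := exists_conj_apply_eq_repr c
  -- In characteristic zero the weights of a nilpotent Lie algebra are linear.
  refine ⟨g, fun i => LieModule.Weight.toLinear ℂ L (Fin n → ℂ) (χ i), fun x => ?_⟩
  -- `T` is the scalar `χ x` on each generalized weight space. By uniqueness of the Jordan
  -- decomposition it is the semisimple part of `ρ x`.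
  let T : Module.End ℂ (Fin n → ℂ) := c.constr ℂ fun i => χ i x • c i
  have hT : ∀ i, T (c i) = χ i x • c i := fun i => c.constr_basis ℂ _ i
  have hTW : ∀ i, ∀ v ∈ LieModule.genWeightSpace (Fin n → ℂ) (χ i), T v = χ i x • v := by
    intro i v hv
    conv_lhs => rw [← c.sum_repr v]
    conv_rhs => rw [← c.sum_repr v]
    rw [map_sum, Finset.smul_sum]
    refine Finset.sum_congr rfl fun j _ => ?_
    rw [map_smul, hT, smul_comm]
    by_cases hj : c.repr v j = 0
    · rw [hj, zero_smul, smul_zero, smul_zero]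
    · rw [hχ i v hv j hj]
  let A : Module.End ℂ (Fin n → ℂ) := Matrix.toLin' (ρ x)
  have hA : ∀ v, A v = ⁅x, v⁆ := fun v => Matrix.toLin'_apply _ _
  have hmem : ∀ i, ∀ v ∈ LieModule.genWeightSpace (Fin n → ℂ) (χ i),
      A v ∈ LieModule.genWeightSpace (Fin n → ℂ) (χ i) := by
    intro i v hv
    rw [hA]
    exact LieSubmodule.lie_mem _ hv
  have hcomm : Commute A T := by
    refine c.ext fun i => ?_
    rw [Module.End.mul_apply, Module.End.mul_apply, hT, map_smul, hTW i _ (hmem i _ (hc i))]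
  have hnil : IsNilpotent (A - T) := by
    refine isNilpotent_of_basis c _ fun i => ?_
    obtain ⟨k, hk⟩ := (LieModule.mem_genWeightSpace _ _ _).1 (hc i) x
    refine ⟨k, ?_⟩
    -- The iterates stay in the weight space of `c i`, where `T` is scalar, so powers of `A - T` act
    -- there as powers of `x - χ x`.
    have hpow : ∀ m : ℕ, ((A - T) ^ m) (c i) =
          ((LieModule.toEnd ℂ L (Fin n → ℂ) x -
            χ i x • (1 : Module.End ℂ (Fin n → ℂ)) : Module.End ℂ (Fin n → ℂ)) ^ m) (c i) ∧
        ((A - T) ^ m) (c i) ∈ LieModule.genWeightSpace (Fin n → ℂ) (χ i) := by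
      intro m
      induction m with
      | zero => exact ⟨rfl, hc i⟩
      | succ m ih =>
        have h1 : (A - T) (((A - T) ^ m) (c i)) =
            A (((A - T) ^ m) (c i)) - χ i x • (((A - T) ^ m) (c i)) := by
          rw [LinearMap.sub_apply, hTW i _ ih.2]
        rw [pow_succ', pow_succ', Module.End.mul_apply, Module.End.mul_apply, ← ih.1, h1]
        refine ⟨?_, ?_⟩
        · rw [LinearMap.sub_apply, LieModule.toEnd_apply_apply, hA]
          rfl
        · exact sub_mem (hmem i _ ih.2) (SMulMemClass.smul_mem _ ih.2)
    rw [(hpow k).1, hk]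
  have hss : T.IsSemisimple := isSemisimple_of_basis_eigenvectors c (fun i => χ i x) T hT
  have hS : LinearMap.toMatrix' T = semisimplePart (ρ x) := by
    refine eq_semisimplePart ?_ ?_ ?_
    · rwa [Matrix.toLin'_toMatrix']
    · have := hnil.map (LinearMap.toMatrixAlgEquiv' (R := ℂ) (n := Fin n))
      rw [map_sub] at this
      rwa [show LinearMap.toMatrixAlgEquiv' A = ρ x from LinearMap.toMatrix'_toLin' _] at this
    · have := hcomm.map (LinearMap.toMatrixAlgEquiv' (R := ℂ) (n := Fin n))
      rwa [show LinearMap.toMatrixAlgEquiv' A = ρ x from LinearMap.toMatrix'_toLin' _] at this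
  ext i j
  rw [hg, ← hS, LinearMap.toMatrix'_mulVec, hT, map_smul, c.repr_self, Finsupp.smul_apply,
    Finsupp.single_apply, Matrix.diagonal_apply]
  by_cases hij : i = j
  · subst hij
    simp
  · simp [hij, Ne.symm hij]

theorem exists_conj_apply_eq_perm {n : ℕ} (σ : Equiv.Perm (Fin n)) :
    ∃ g : GL (Fin n) ℂ, ∀ (A : Matrix (Fin n) (Fin n) ℂ) (i j : Fin n),
      (g.1 * A * g⁻¹.1) i j = A (σ i) (σ j) := by
  obtain ⟨g, hg⟩ := exists_conj_apply_eq_repr ((Pi.basisFun ℂ (Fin n)).reindex σ.symm)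
  refine ⟨g, fun A i j => ?_⟩
  rw [hg]
  simp

/-! ### Regular functions and degeneration to diagonal representations -/

section RepresentationLemmas

variable {𝔫 : Type u} [LieRing 𝔫] [LieAlgebra ℂ 𝔫] {n : ℕ}

theorem continuous_comp_of_mem_repFunctions {r : ℂ → LieRep 𝔫 n}
    (hr : ∀ x i j, Continuous fun t => r t x i j) {f : LieRep 𝔫 n → ℂ}
    (hf : f ∈ repFunctions 𝔫 n) : Continuous fun t => f (r t) := by
  induction hf using Algebra.adjoin_induction with
  | mem f hf =>
    obtain ⟨p, rfl⟩ := hf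
    exact hr _ _ _
  | algebraMap c => exact continuous_const
  | add f g _ _ hf hg => exact hf.add hg
  | mul f g _ _ hf hg => exact hf.mul hg

theorem entry_mem_repFunctions (x : 𝔫) (i j : Fin n) :
    (fun ρ : LieRep 𝔫 n => ρ x i j) ∈ repFunctions 𝔫 n :=
  Algebra.subset_adjoin ⟨(x, i, j), rfl⟩

theorem const_mem_repFunctions (c : ℂ) : (fun _ : LieRep 𝔫 n => c) ∈ repFunctions 𝔫 n :=
  (repFunctions 𝔫 n).algebraMap_mem c

theorem det_mem_repFunctions {M : LieRep 𝔫 n → Matrix (Fin n) (Fin n) ℂ}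
    (hM : ∀ i j, (fun ρ => M ρ i j) ∈ repFunctions 𝔫 n) :
    (fun ρ => (M ρ).det) ∈ repFunctions 𝔫 n := by
  have h : (fun ρ => (M ρ).det) = ∑ σ : Equiv.Perm (Fin n),
      Equiv.Perm.sign σ • ∏ i, fun ρ => M ρ (σ i) i := by
    funext ρ
    simp [Matrix.det_apply, Finset.sum_apply, Finset.prod_apply]
  rw [h]
  refine Subalgebra.sum_mem _ fun σ _ => ?_
  have hp := Subalgebra.prod_mem (repFunctions 𝔫 n) (t := Finset.univ)
    (f := fun (i : Fin n) (ρ : LieRep 𝔫 n) => M ρ (σ i) i) fun i _ => hM _ _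
  rcases Int.units_eq_one_or (Equiv.Perm.sign σ) with h | h
  · rw [h, one_smul]
    exact hp
  · rw [h, Units.neg_smul, one_smul]
    exact neg_mem hp

theorem mul_entry_mem_repFunctions {M N : LieRep 𝔫 n → Matrix (Fin n) (Fin n) ℂ}
    (hM : ∀ i j, (fun ρ => M ρ i j) ∈ repFunctions 𝔫 n)
    (hN : ∀ i j, (fun ρ => N ρ i j) ∈ repFunctions 𝔫 n) (i j : Fin n) :
    (fun ρ => (M ρ * N ρ) i j) ∈ repFunctions 𝔫 n := by
  have h : (fun ρ => (M ρ * N ρ) i j) =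
      ∑ k, (fun ρ => M ρ i k) * (fun ρ => N ρ k j) := by
    funext ρ
    simp [Matrix.mul_apply, Finset.sum_apply]
  rw [h]
  exact Subalgebra.sum_mem _ fun k _ => Subalgebra.mul_mem _ (hM i k) (hN k j)

theorem conj_mul_conj (g : GL (Fin n) ℂ) (A B : Matrix (Fin n) (Fin n) ℂ) :
    (g.1 * A * g⁻¹.1) * (g.1 * B * g⁻¹.1) = g.1 * (A * B) * g⁻¹.1 := by
  have h : g⁻¹.1 * g.1 = 1 := g.inv_mul
  calc _ = g.1 * A * (g⁻¹.1 * g.1) * B * g⁻¹.1 := by simp only [mul_assoc]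
    _ = _ := by rw [h]; simp only [mul_assoc, mul_one]

theorem charpoly_conj (g : GL (Fin n) ℂ) (A : Matrix (Fin n) (Fin n) ℂ) :
    (g.1 * A * g⁻¹.1).charpoly = A.charpoly :=
  by rw [Matrix.coe_units_inv]; exact Matrix.charpoly_units_conj g A

/-- The values of the characteristic polynomial of `ρ(x)` are invariant regular functions. -/
theorem exists_invariant_eq_eval_charpoly (x : 𝔫) (t : ℂ) :
    ∃ f : repInvariants 𝔫 n, ∀ ρ, f.1.1 ρ = (ρ x).charpoly.eval t := by
  refine ⟨⟨⟨fun ρ => (ρ x).charpoly.eval t, ?_⟩, fun g ρ => ?_⟩, fun ρ => rfl⟩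
  · have h : (fun ρ : LieRep 𝔫 n => (ρ x).charpoly.eval t) =
        fun ρ => (Matrix.scalar (Fin n) t - ρ x).det := by
      funext ρ
      rw [Matrix.eval_charpoly]
    rw [h]
    exact det_mem_repFunctions fun i j => sub_mem (const_mem_repFunctions _)
      (entry_mem_repFunctions x i j)
  · change (g.1 * ρ x * g⁻¹.1).charpoly.eval t = _
    rw [charpoly_conj]

/-- The diagonal entries of a representation, as linear functionals. -/
def diagEntry (ρ : LieRep 𝔫 n) (i : Fin n) : 𝔫 →ₗ[ℂ] ℂ where
  toFun x := ρ x i i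
  map_add' x y := by rw [map_add, Matrix.add_apply]
  map_smul' c x := by rw [map_smul, Matrix.smul_apply, RingHom.id_apply]

theorem diagRep_apply_self {l : ℕ} (b : Module.Basis (Fin l) ℂ (LieAbelianization 𝔫))
    (v : Fin n → Fin l → ℂ) (x : 𝔫) (i : Fin n) : diagRep b v x i i =
      ∑ j, b.repr (LieSubmodule.Quotient.mk x : LieAbelianization 𝔫) j * v i j :=
  Matrix.diagonal_apply_eq _ _

theorem diagRep_apply_ne {l : ℕ} (b : Module.Basis (Fin l) ℂ (LieAbelianization 𝔫))
    (v : Fin n → Fin l → ℂ) (x : 𝔫) {i j : Fin n} (h : i ≠ j) : diagRep b v x i j = 0 :=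
  Matrix.diagonal_apply_ne _ h

/-- Every diagonal representation is a `diagRep`. -/
theorem exists_eq_diagRep {l : ℕ} (b : Module.Basis (Fin l) ℂ (LieAbelianization 𝔫))
    (δ : LieRep 𝔫 n) (hδ : ∀ x, (δ x).IsDiag) : ∃ v, δ = diagRep b v := by
  have hlift : ∀ j, ∃ y : 𝔫, (LieSubmodule.Quotient.mk y : LieAbelianization 𝔫) = b j :=
    fun j => LieSubmodule.Quotient.surjective_mk' _ (b j)
  choose y hy using hlift
  have hbr : ∀ x z : 𝔫, δ ⁅x, z⁆ = 0 := by
    intro x z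
    rw [LieHom.map_lie, Ring.lie_def, ← (hδ x).diagonal_diag, ← (hδ z).diagonal_diag,
      Matrix.diagonal_mul_diagonal, Matrix.diagonal_mul_diagonal]
    simp [mul_comm]
  -- Diagonal matrices commute, so `δ` factors through the abelianization and is fixed by its values
  -- on lifts of `b`.
  have hker : ∀ x ∈ ⁅(⊤ : LieIdeal ℂ 𝔫), (⊤ : LieIdeal ℂ 𝔫)⁆, δ x = 0 := by
    have hle : ⁅(⊤ : LieIdeal ℂ 𝔫), (⊤ : LieIdeal ℂ 𝔫)⁆ ≤ δ.ker := by
      rw [LieSubmodule.lie_le_iff]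
      intro x _ z _
      rw [LieHom.mem_ker]
      exact hbr x z
    exact fun x hx => LieHom.mem_ker.1 (hle hx)
  refine ⟨fun i j => δ (y j) i i, ?_⟩
  ext x i k
  by_cases hik : i = k
  · subst hik
    rw [diagRep_apply_self]
    have hx : x - ∑ j, b.repr (LieSubmodule.Quotient.mk x : LieAbelianization 𝔫) j • y j ∈
        ⁅(⊤ : LieIdeal ℂ 𝔫), (⊤ : LieIdeal ℂ 𝔫)⁆ := by
      rw [← LieSubmodule.Quotient.mk_eq_zero]
      rw [map_sub, map_sum, sub_eq_zero]
      refine (b.sum_repr _).symm.trans (Finset.sum_congr rfl fun j _ => ?_)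
      rw [map_smul, ← hy]
      rfl
    have h0 := hker _ hx
    rw [map_sub, sub_eq_zero, map_sum] at h0
    rw [h0, Matrix.sum_apply]
    exact Finset.sum_congr rfl fun j _ => by rw [map_smul, Matrix.smul_apply, smul_eq_mul]
  · rw [diagRep_apply_ne b _ x hik]
    exact hδ x hik

/-- The degeneration of a lower triangular representation to its diagonal part. -/
def scaleLowerRep (ρ : LieRep 𝔫 n) (hρ : ∀ x (i j : Fin n), i < j → ρ x i j = 0) (t : ℂ) :
    LieRep 𝔫 n where
  -- The subtraction is truncated, which is harmless because entries above the diagonal vanish. At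
  -- `t = 0` the convention `0 ^ 0 = 1` keeps exactly the diagonal.
  toFun x := Matrix.of fun i j => t ^ (i.1 - j.1) * ρ x i j
  map_add' x y := by
    ext i j
    simp [mul_add]
  map_smul' c x := by
    ext i j
    simp [mul_left_comm]
  map_lie' {x y} := by
    have key : ∀ x y, (Matrix.of fun i j : Fin n => t ^ (i.1 - j.1) * ρ x i j) *
        (Matrix.of fun i j : Fin n => t ^ (i.1 - j.1) * ρ y i j) =
        Matrix.of fun i j : Fin n => t ^ (i.1 - j.1) * (ρ x * ρ y) i j := by
      intro x y
      ext i j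
      rw [Matrix.mul_apply, Matrix.of_apply, Matrix.mul_apply, Finset.mul_sum]
      refine Finset.sum_congr rfl fun k _ => ?_
      simp only [Matrix.of_apply]
      by_cases h1 : i < k
      · simp [hρ x i k h1]
      by_cases h2 : k < j
      · simp [hρ y k j h2]
      have : i.1 - j.1 = (i.1 - k.1) + (k.1 - j.1) := by
        rw [Fin.lt_def] at h1 h2
        omega
      rw [this, pow_add]
      ring
    change _ = _ * _ - _ * _
    rw [key, key, LieHom.map_lie, Ring.lie_def]
    ext i j
    simp [mul_sub]

/-- Invariant functions on a representation of a nilpotent Lie algebra are determined by its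
degenerate diagonal form. -/
theorem exists_forall_invariant_eq_diagRep [FiniteDimensional ℂ 𝔫] [LieAlgebra.IsSolvable 𝔫]
    {l : ℕ} (b : Module.Basis (Fin l) ℂ (LieAbelianization 𝔫)) (ρ : LieRep 𝔫 n) :
    ∃ v, ∀ f : repInvariants 𝔫 n, f.1.1 ρ = f.1.1 (diagRep b v) := by
  let : LieRingModule 𝔫 (Fin n → ℂ) := LieRingModule.compLieHom (Fin n → ℂ) ρ
  let : LieModule ℂ 𝔫 (Fin n → ℂ) := LieModule.compLieHom (Fin n → ℂ) ρ
  obtain ⟨c, hc⟩ := exists_basis_forall_repr_eq_zero (L := 𝔫) n (Fin n → ℂ) (by simp)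
  obtain ⟨g, hg⟩ := exists_conj_apply_eq_repr c
  have hlow : ∀ x (i j : Fin n), i < j → conjRep g ρ x i j = 0 := by
    intro x i j hij
    exact (hg _ _ _).trans (hc x i j hij)
  let r : ℂ → LieRep 𝔫 n := scaleLowerRep (conjRep g ρ) hlow
  have hr : ∀ t x i j, r t x i j = t ^ (i.1 - j.1) * conjRep g ρ x i j := fun _ _ _ _ => rfl
  obtain ⟨v, hv⟩ := exists_eq_diagRep b (r 0) (by
    intro x i j hij
    rw [hr]
    rcases lt_or_gt_of_ne hij with h | h
    · rw [hlow x i j h, mul_zero]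
    · rw [zero_pow (Nat.sub_ne_zero_of_lt h), zero_mul])
  refine ⟨v, fun f => ?_⟩
  have hcont : Continuous fun t => f.1.1 (r t) := by
    refine continuous_comp_of_mem_repFunctions (fun x i j => ?_) f.1.2
    simp only [hr]
    fun_prop
  -- For `t ≠ 0`, `r t` is a conjugate of `ρ`; density of `t ≠ 0` and continuity carry the value to
  -- `t = 0`.
  have hconst : ∀ t ≠ 0, f.1.1 (r t) = f.1.1 ρ := by
    intro t ht
    let u : GL (Fin n) ℂ :=
      ⟨Matrix.diagonal fun i => t ^ i.1, Matrix.diagonal fun i => (t ^ i.1)⁻¹,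
        by simp [Matrix.diagonal_mul_diagonal, ht], by simp [Matrix.diagonal_mul_diagonal, ht]⟩
    have hu : r t = conjRep u (conjRep g ρ) := by
      ext x i j
      have : conjRep u (conjRep g ρ) x i j = t ^ i.1 * conjRep g ρ x i j * (t ^ j.1)⁻¹ := by
        change (Matrix.diagonal _ * conjRep g ρ x * Matrix.diagonal _ : Matrix _ _ ℂ) i j = _
        rw [Matrix.mul_diagonal, Matrix.diagonal_mul]
      rw [this, hr]
      by_cases hij : i < j
      · simp [hlow x i j hij]
      · rw [pow_sub₀ t ht (by rw [Fin.lt_def] at hij; omega)]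
        ring
    rw [hu, f.2 u, f.2 g]
  have hfun : (fun t => f.1.1 (r t)) = fun _ => f.1.1 ρ :=
    Continuous.ext_on (dense_compl_singleton (0 : ℂ)) hcont continuous_const
      fun t ht => hconst t ht
  rw [← hv]
  exact (congrFun hfun 0).symm

/-- Permuting the joint eigenvalues is conjugation by a permutation matrix. -/
theorem invariant_diagRep_perm {l : ℕ} (b : Module.Basis (Fin l) ℂ (LieAbelianization 𝔫))
    (v : Fin n → Fin l → ℂ) (σ : Equiv.Perm (Fin n)) (f : repInvariants 𝔫 n) :
    f.1.1 (diagRep b (v ∘ σ)) = f.1.1 (diagRep b v) := by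
  obtain ⟨g, hg⟩ := exists_conj_apply_eq_perm σ
  rw [← f.2 g (diagRep b v)]
  refine congrArg f.1.1 ?_
  ext x i j
  refine Eq.trans ?_ (hg _ _ _).symm
  by_cases hij : i = j
  · subst hij
    rw [diagRep_apply_self, diagRep_apply_self]
    rfl
  · rw [diagRep_apply_ne b _ x hij, diagRep_apply_ne b _ x (σ.injective.ne hij)]

theorem charpoly_eq_of_forall_invariant_eq {ρ₁ ρ₂ : LieRep 𝔫 n}
    (h : ∀ f : repInvariants 𝔫 n, f.1.1 ρ₁ = f.1.1 ρ₂) (x : 𝔫) :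
    (ρ₁ x).charpoly = (ρ₂ x).charpoly := by
  refine Polynomial.funext fun t => ?_
  obtain ⟨f, hf⟩ := exists_invariant_eq_eval_charpoly (n := n) x t
  rw [← hf, ← hf, h]

/-- Linear families of diagonal matrices with the same characteristic polynomials agree up to a
permutation of the diagonal entries. -/
theorem exists_perm_of_charpoly_diagonal_eq (α β : Fin n → 𝔫 →ₗ[ℂ] ℂ)
    (h : ∀ x, (Matrix.diagonal fun i => α i x).charpoly =
      (Matrix.diagonal fun i => β i x).charpoly) :
    ∃ σ : Equiv.Perm (Fin n), ∀ x i, α i x = β (σ i) x := by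
  refine exists_perm_of_forall_exists_perm α β fun x => ?_
  refine exists_perm_of_prod_X_sub_C_eq (fun i => α i x) (fun i => β i x) ?_
  simpa only [Matrix.charpoly_diagonal] using h x

/-- Representations of a nilpotent Lie algebra with the same characteristic polynomials are not
separated by invariant functions. -/
theorem invariant_eq_of_forall_charpoly_eq [FiniteDimensional ℂ 𝔫] [LieAlgebra.IsSolvable 𝔫]
    {ρ₁ ρ₂ : LieRep 𝔫 n} (h : ∀ x, (ρ₁ x).charpoly = (ρ₂ x).charpoly)
    (f : repInvariants 𝔫 n) : f.1.1 ρ₁ = f.1.1 ρ₂ := by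
  let b := Module.finBasis ℂ (LieAbelianization 𝔫)
  obtain ⟨v₁, h₁⟩ := exists_forall_invariant_eq_diagRep b ρ₁
  obtain ⟨v₂, h₂⟩ := exists_forall_invariant_eq_diagRep b ρ₂
  have hd : ∀ (v : Fin n → _ → ℂ) x,
      (Matrix.diagonal fun i => diagEntry (diagRep b v) i x) = diagRep b v x := by
    intro v x
    ext i j
    by_cases hij : i = j
    · subst hij
      rw [Matrix.diagonal_apply_eq]
      rfl
    · rw [Matrix.diagonal_apply_ne _ hij, diagRep_apply_ne b _ x hij]
  obtain ⟨σ, hσ⟩ := exists_perm_of_charpoly_diagonal_eq (diagEntry (diagRep b v₁))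
    (diagEntry (diagRep b v₂)) fun x => by
      rw [hd, hd, ← charpoly_eq_of_forall_invariant_eq h₁, ← charpoly_eq_of_forall_invariant_eq h₂,
        h]
  rw [h₁, h₂, ← invariant_diagRep_perm b v₂ σ]
  refine congrArg f.1.1 ?_
  ext x i j
  by_cases hij : i = j
  · subst hij
    refine (hσ x i).trans ?_
    change diagRep b v₂ x _ _ = _
    rw [diagRep_apply_self, diagRep_apply_self]
    rfl
  · rw [diagRep_apply_ne b _ x hij, diagRep_apply_ne b _ x hij]

end RepresentationLemmas

/-! ### Invariant functions as multisymmetric polynomials -/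

/-- The inclusion-exclusion formula for the permanent (Ryser). -/
theorem sum_neg_one_pow_prod_sum_compl {ι R : Type*} [Fintype ι] [DecidableEq ι] [CommRing R]
    (a : ι → ι → R) :
    ∑ S : Finset ι, (-1) ^ S.card * ∏ k, ∑ i ∈ Sᶜ, a i k =
      ∑ σ : Equiv.Perm ι, ∏ i, a i (σ i) := by
  have h1 : ∀ S : Finset ι, ∏ k, ∑ i ∈ Sᶜ, a i k =
      ∑ h : ι → ι, if S ⊆ (Finset.univ.image h)ᶜ then ∏ k, a (h k) k else 0 := by
    intro S
    rw [Finset.prod_univ_sum, ← Finset.sum_filter]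
    refine Finset.sum_congr ?_ fun _ _ => rfl
    ext h
    simp only [Fintype.mem_piFinset, Finset.mem_filter, Finset.mem_univ, true_and,
      Finset.subset_iff, Finset.mem_compl, Finset.mem_image, not_exists]
    exact ⟨fun hh x hx k hk => hh k (hk ▸ hx), fun hh k hk => hh hk k rfl⟩
  -- The alternating sum over subsets of the complement of the image of `h` keeps only the
  -- surjective `h`, that is, the permutations.
  have h2 : ∀ T : Finset ι, (∑ S : Finset ι, if S ⊆ T then (-1 : R) ^ S.card else 0) =
      if T = ∅ then 1 else 0 := by
    intro T
    have := congrArg (Int.cast : ℤ → R) (Finset.sum_powerset_neg_one_pow_card (x := T))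
    push_cast at this
    rw [← this, ← Finset.sum_filter]
    refine Finset.sum_congr ?_ fun _ _ => rfl
    ext S
    simp
  calc ∑ S : Finset ι, (-1) ^ S.card * ∏ k, ∑ i ∈ Sᶜ, a i k
      = ∑ h : ι → ι, ∑ S : Finset ι,
          (if S ⊆ (Finset.univ.image h)ᶜ then (-1 : R) ^ S.card else 0) * ∏ k, a (h k) k := by
        rw [Finset.sum_comm]
        refine Finset.sum_congr rfl fun S _ => ?_
        rw [h1, Finset.mul_sum]
        refine Finset.sum_congr rfl fun h _ => ?_
        split_ifs <;> simp
    _ = ∑ h : ι → ι, if Function.Bijective h then ∏ k, a (h k) k else 0 := by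
        refine Finset.sum_congr rfl fun h _ => ?_
        rw [← Finset.sum_mul, h2]
        have : (Finset.univ.image h)ᶜ = ∅ ↔ Function.Bijective h := by
          rw [Finset.compl_eq_empty_iff, ← Finite.surjective_iff_bijective, Finset.eq_univ_iff_forall]
          simp [Function.Surjective]
        simp only [this]
        split_ifs <;> simp
    _ = ∑ σ : Equiv.Perm ι, ∏ k, a (σ k) k := by
        rw [← Finset.sum_filter]
        refine (Finset.sum_bij (fun (σ : Equiv.Perm ι) _ => (σ : ι → ι)) ?_ ?_ ?_ ?_).symm
        · intro σ _
          simp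
        · intro σ _ τ _ h
          exact DFunLike.coe_injective h
        · intro h hh
          exact ⟨Equiv.ofBijective h (by simpa using hh), Finset.mem_univ _, rfl⟩
        · intro σ _
          rfl
    _ = _ := by
        refine Fintype.sum_equiv (Equiv.inv _) _ _ fun σ => ?_
        refine Fintype.prod_equiv σ _ _ fun k => ?_
        simp

section InvariantsOfRepresentations

variable {𝔫 : Type u} [LieRing 𝔫] [LieAlgebra ℂ 𝔫] {n : ℕ}

variable (𝔫 n) in
/-- The algebra of equivariant regular maps from the representation variety to matrices. -/
def equivariantMatrices : Subalgebra ℂ (LieRep 𝔫 n → Matrix (Fin n) (Fin n) ℂ) where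
  carrier := {M | (∀ i j, (fun ρ => M ρ i j) ∈ repFunctions 𝔫 n) ∧
    ∀ (g : GL (Fin n) ℂ) ρ, M (conjRep g ρ) = g.1 * M ρ * g⁻¹.1}
  mul_mem' {M N} hM hN := by
    refine ⟨mul_entry_mem_repFunctions hM.1 hN.1, fun g ρ => ?_⟩
    rw [Pi.mul_apply, hM.2, hN.2, conj_mul_conj, Pi.mul_apply]
  add_mem' {M N} hM hN := by
    refine ⟨fun i j => add_mem (hM.1 i j) (hN.1 i j), fun g ρ => ?_⟩
    rw [Pi.add_apply, hM.2, hN.2, Pi.add_apply, mul_add, add_mul]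
  algebraMap_mem' c := by
    refine ⟨fun i j => const_mem_repFunctions _, fun g ρ => ?_⟩
    have h : g.1 * g⁻¹.1 = 1 := g.mul_inv
    change algebraMap ℂ (Matrix (Fin n) (Fin n) ℂ) c = g.1 * algebraMap ℂ _ c * g⁻¹.1
    rw [← Algebra.commutes, mul_assoc, h, mul_one]

theorem apply_mem_equivariantMatrices (x : 𝔫) :
    (fun ρ : LieRep 𝔫 n => ρ x) ∈ equivariantMatrices 𝔫 n :=
  ⟨entry_mem_repFunctions x, fun _ _ => rfl⟩

theorem exists_invariant_eq_det {M : LieRep 𝔫 n → Matrix (Fin n) (Fin n) ℂ}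
    (hM : M ∈ equivariantMatrices 𝔫 n) :
    ∃ f : repInvariants 𝔫 n, ∀ ρ, f.1.1 ρ = (M ρ).det := by
  refine ⟨⟨⟨_, det_mem_repFunctions hM.1⟩, fun g ρ => ?_⟩, fun ρ => rfl⟩
  change (M (conjRep g ρ)).det = (M ρ).det
  rw [hM.2, Matrix.coe_units_inv, Matrix.det_conj g.isUnit]

/-- A lift `y` of `b j` acts on `diagRep b v` as the diagonal of the `j`-th coordinates. Products of
powers of such `ρ y` are equivariant for every `ρ`, although the factors need not commute. -/
theorem exists_equivariant_diagRep_eq_prod_pow {l : ℕ}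
    (b : Module.Basis (Fin l) ℂ (LieAbelianization 𝔫)) (e : Fin l → ℕ) (s : Finset (Fin l)) :
    ∃ M ∈ equivariantMatrices 𝔫 n, ∀ v : Fin n → Fin l → ℂ,
      M (diagRep b v) = Matrix.diagonal fun k => ∏ j ∈ s, v k j ^ e j := by
  induction s using Finset.induction_on with
  | empty => exact ⟨1, one_mem _, fun v => by simp⟩
  | insert j s hj ih =>
    obtain ⟨M, hM, hv⟩ := ih
    obtain ⟨y, hy⟩ : ∃ y : 𝔫, (LieSubmodule.Quotient.mk y : LieAbelianization 𝔫) = b j :=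
      LieSubmodule.Quotient.surjective_mk' _ (b j)
    have hd : ∀ v : Fin n → Fin l → ℂ, diagRep b v y = Matrix.diagonal fun k => v k j := by
      intro v
      refine congrArg Matrix.diagonal (funext fun k => ?_)
      rw [hy, b.repr_self, Finset.sum_eq_single j]
      · simp
      · intro i _ hi
        rw [Finsupp.single_eq_of_ne hi, zero_mul]
      · simp
    refine ⟨_, mul_mem (pow_mem (apply_mem_equivariantMatrices y) (e j)) hM, fun v => ?_⟩
    rw [Pi.mul_apply, Pi.pow_apply, hv, hd, Matrix.diagonal_pow, Matrix.diagonal_mul_diagonal]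
    refine congrArg Matrix.diagonal (funext fun k => ?_)
    rw [Finset.prod_insert hj]
    rfl

/-- The symmetrization of a polynomial extends to an invariant function. -/
theorem exists_invariant_diagRep_eq_sum_perm {l : ℕ}
    (b : Module.Basis (Fin l) ℂ (LieAbelianization 𝔫)) (p : MvPolynomial (Fin n × Fin l) ℂ) :
    ∃ f : repInvariants 𝔫 n, ∀ v : Fin n → Fin l → ℂ, f.1.1 (diagRep b v) =
      ∑ σ : Equiv.Perm (Fin n), MvPolynomial.eval (fun q => v (σ q.1) q.2) p := by
  induction p using MvPolynomial.induction_on' with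
  | monomial s c =>
    -- With `a i k = ∏ j, v k j ^ s (i, j)`, the symmetrized monomial is the permanent of `a`. Each
    -- product `∏ k, ∑ i ∈ Sᶜ, a i k` in Ryser's formula is the determinant of `∑ i ∈ Sᶜ, M i` at
    -- `diagRep b v`.
    choose M hM hv using fun i =>
      exists_equivariant_diagRep_eq_prod_pow (n := n) b (fun j => s (i, j)) Finset.univ
    choose D hD using fun S : Finset (Fin n) =>
      exists_invariant_eq_det (Subalgebra.sum_mem (equivariantMatrices 𝔫 n) (t := Sᶜ)
        (f := M) fun i _ => hM i)
    refine ⟨c • ∑ S : Finset (Fin n), (-1 : ℂ) ^ S.card • D S, fun v => ?_⟩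
    have hval : (c • ∑ S : Finset (Fin n), (-1 : ℂ) ^ S.card • D S).1.1 (diagRep b v) =
        c * ∑ S : Finset (Fin n), (-1 : ℂ) ^ S.card * (D S).1.1 (diagRep b v) := by
      let E : repInvariants 𝔫 n →ₐ[ℂ] ℂ := (Pi.evalAlgHom ℂ (fun _ : LieRep 𝔫 n => ℂ)
        (diagRep b v)).comp ((repFunctions 𝔫 n).val.comp (repInvariants 𝔫 n).val)
      change E (c • ∑ S : Finset (Fin n), (-1 : ℂ) ^ S.card • D S) = c * ∑ S : Finset (Fin n), (-1 : ℂ) ^ S.card * E (D S)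
      simp only [map_smul, map_sum, smul_eq_mul]
    have hdet : ∀ S, (D S).1.1 (diagRep b v) =
        ∏ k, ∑ i ∈ Sᶜ, ∏ j, v k j ^ s (i, j) := by
      intro S
      have : ∑ i ∈ Sᶜ, M i (diagRep b v) =
          Matrix.diagonal fun k => ∑ i ∈ Sᶜ, ∏ j, v k j ^ s (i, j) := by
        simp only [hv]
        ext i k
        rw [Matrix.sum_apply]
        by_cases hik : i = k
        · subst hik
          simp
        · simp [hik]
      rw [hD, Finset.sum_apply, this, Matrix.det_diagonal]
    simp only [hval, hdet]
    rw [sum_neg_one_pow_prod_sum_compl (fun i k => ∏ j, v k j ^ s (i, j)), Finset.mul_sum]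
    refine Finset.sum_congr rfl fun σ _ => ?_
    rw [MvPolynomial.eval_monomial, Finsupp.prod_fintype _ _ (by simp), Fintype.prod_prod_type]
  | add p q hp hq =>
    obtain ⟨f, hf⟩ := hp
    obtain ⟨g, hg⟩ := hq
    refine ⟨f + g, fun v => ?_⟩
    simp only [map_add, Finset.sum_add_distrib, ← hf, ← hg]
    rfl

theorem exists_eval_eq_diagRep {l : ℕ} (b : Module.Basis (Fin l) ℂ (LieAbelianization 𝔫))
    {f : LieRep 𝔫 n → ℂ} (hf : f ∈ repFunctions 𝔫 n) :
    ∃ p : MvPolynomial (Fin n × Fin l) ℂ, ∀ v : Fin n → Fin l → ℂ,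
      MvPolynomial.eval (fun q => v q.1 q.2) p = f (diagRep b v) := by
  induction hf using Algebra.adjoin_induction with
  | mem f hf =>
    obtain ⟨⟨x, i, j⟩, rfl⟩ := hf
    by_cases hij : i = j
    · subst hij
      refine ⟨∑ k, MvPolynomial.C (b.repr (LieSubmodule.Quotient.mk x : LieAbelianization 𝔫) k) *
        MvPolynomial.X (i, k), fun v => ?_⟩
      simp [diagRep_apply_self]
    · exact ⟨0, fun v => by simp [diagRep_apply_ne b v x hij]⟩
  | algebraMap c => exact ⟨MvPolynomial.C c, fun v => by simp⟩
  | add f g _ _ hf hg =>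
    obtain ⟨p, hp⟩ := hf
    obtain ⟨q, hq⟩ := hg
    exact ⟨p + q, fun v => by simp [hp, hq]⟩
  | mul f g _ _ hf hg =>
    obtain ⟨p, hp⟩ := hf
    obtain ⟨q, hq⟩ := hg
    exact ⟨p * q, fun v => by simp [hp, hq]⟩

theorem mem_multisymmetric_iff {l : ℕ} {p : MvPolynomial (Fin n × Fin l) ℂ} :
    p ∈ multisymmetric n l ↔ ∀ (σ : Equiv.Perm (Fin n)) (v : Fin n → Fin l → ℂ),
      MvPolynomial.eval (fun q => v (σ q.1) q.2) p = MvPolynomial.eval (fun q => v q.1 q.2) p := by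
  change (∀ σ : Equiv.Perm (Fin n), MvPolynomial.rename (Prod.map σ id) p = p) ↔ _
  refine forall_congr' fun σ => ⟨fun h v => ?_, fun h => MvPolynomial.funext fun w => ?_⟩
  · conv_rhs => rw [← h, MvPolynomial.eval_rename]
    rfl
  · rw [MvPolynomial.eval_rename]
    exact h fun i j => w (i, j)

/-- Evaluation of multisymmetric polynomials at tuples. -/
def multisymmetricEval (n l : ℕ) : multisymmetric n l →ₐ[ℂ] ((Fin n → Fin l → ℂ) → ℂ) :=
  AlgHom.pi fun v => (MvPolynomial.aeval fun q : Fin n × Fin l => v q.1 q.2).comp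
    (multisymmetric n l).val

/-- Restriction of invariant functions to the diagonal representations. -/
def invariantDiagEval {l : ℕ} (b : Module.Basis (Fin l) ℂ (LieAbelianization 𝔫)) :
    repInvariants 𝔫 n →ₐ[ℂ] ((Fin n → Fin l → ℂ) → ℂ) :=
  AlgHom.pi fun v => (Pi.evalAlgHom ℂ (fun _ : LieRep 𝔫 n => ℂ) (diagRep b v)).comp
    ((repFunctions 𝔫 n).val.comp (repInvariants 𝔫 n).val)

theorem multisymmetricEval_apply {l : ℕ} (p : multisymmetric n l) (v : Fin n → Fin l → ℂ) :
    multisymmetricEval n l p v = MvPolynomial.eval (fun q => v q.1 q.2) p.1 :=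
  congrFun (congrArg DFunLike.coe (MvPolynomial.coe_aeval_eq_eval fun q : Fin n × Fin l =>
    v q.1 q.2)) p.1

theorem multisymmetricEval_injective (n l : ℕ) :
    Function.Injective (multisymmetricEval n l) := by
  intro p q h
  refine Subtype.ext (MvPolynomial.funext fun w => ?_)
  have := congrFun h fun i j => w (i, j)
  rwa [multisymmetricEval_apply, multisymmetricEval_apply] at this

theorem invariantDiagEval_injective [FiniteDimensional ℂ 𝔫] [LieAlgebra.IsSolvable 𝔫] {l : ℕ}
    (b : Module.Basis (Fin l) ℂ (LieAbelianization 𝔫)) :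
    Function.Injective (invariantDiagEval (n := n) b) := by
  intro f g h
  refine Subtype.ext (Subtype.ext (funext fun ρ => ?_))
  obtain ⟨v, hv⟩ := exists_forall_invariant_eq_diagRep b ρ
  rw [hv, hv]
  exact congrFun h v

theorem range_multisymmetricEval {l : ℕ} (b : Module.Basis (Fin l) ℂ (LieAbelianization 𝔫)) :
    (multisymmetricEval n l).range = (invariantDiagEval (n := n) b).range := by
  refine le_antisymm ?_ ?_
  · rintro _ ⟨p, rfl⟩
    obtain ⟨f, hf⟩ := exists_invariant_diagRep_eq_sum_perm b p.1
    -- Averaging: symmetrizing an invariant polynomial multiplies it by `n!`.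
    refine ⟨((n.factorial : ℂ)⁻¹) • f, funext fun v => ?_⟩
    change (n.factorial : ℂ)⁻¹ * f.1.1 (diagRep b v) = multisymmetricEval n l p v
    have hn : (n.factorial : ℂ) ≠ 0 := Nat.cast_ne_zero.2 n.factorial_ne_zero
    rw [hf, multisymmetricEval_apply,
      Finset.sum_congr rfl fun σ _ => mem_multisymmetric_iff.1 p.2 σ v, Finset.sum_const,
      Finset.card_univ, Fintype.card_perm, Fintype.card_fin, nsmul_eq_mul,
      inv_mul_cancel_left₀ hn]
  · rintro _ ⟨f, rfl⟩
    obtain ⟨p, hp⟩ := exists_eval_eq_diagRep b f.1.2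
    refine ⟨⟨p, mem_multisymmetric_iff.2 fun σ v => ?_⟩, funext fun v => ?_⟩
    · rw [hp, ← invariant_diagRep_perm b v σ f]
      exact hp (v ∘ σ)
    · exact (multisymmetricEval_apply _ v).trans (hp v)

/-- Invariant functions are multisymmetric polynomials in the joint eigenvalues. -/
theorem exists_algEquiv_multisymmetric [FiniteDimensional ℂ 𝔫] [LieAlgebra.IsSolvable 𝔫] {l : ℕ}
    (b : Module.Basis (Fin l) ℂ (LieAbelianization 𝔫)) :
    ∃ e : repInvariants 𝔫 n ≃ₐ[ℂ] multisymmetric n l, ∀ f v,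
      MvPolynomial.aeval (fun q : Fin n × Fin l => v q.1 q.2) (e f).1 = f.1.1 (diagRep b v) := by
  let e₁ := AlgEquiv.ofInjective _ (invariantDiagEval_injective (n := n) b)
  let e₂ := AlgEquiv.ofInjective _ (multisymmetricEval_injective n l)
  let e₃ := Subalgebra.equivOfEq _ _ (range_multisymmetricEval (n := n) b).symm
  refine ⟨e₁.trans (e₃.trans e₂.symm), fun f v => ?_⟩
  change multisymmetricEval n l (e₂.symm (e₃ (e₁ f))) v = invariantDiagEval b f v
  have h : (e₂ (e₂.symm (e₃ (e₁ f)))).1 = (e₃ (e₁ f)).1 := by rw [AlgEquiv.apply_symm_apply]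
  exact congrFun h v

end InvariantsOfRepresentations

/-! ### Passage to schemes and the fibres of the quotient map -/

theorem complexSpecMap_comp {A B C : Type u} [CommRing A] [Algebra ℂ A] [CommRing B] [Algebra ℂ B]
    [CommRing C] [Algebra ℂ C] (φ : A →ₐ[ℂ] B) (ψ : B →ₐ[ℂ] C) :
    complexSpecMap ψ ≫ complexSpecMap φ = complexSpecMap (ψ.comp φ) := by
  refine Over.OverMorphism.ext ?_
  change Spec.map _ ≫ Spec.map _ = Spec.map _
  rw [← Spec.map_comp, ← CommRingCat.ofHom_comp]
  rfl

theorem complexSpecMap_id (A : Type u) [CommRing A] [Algebra ℂ A] :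
    complexSpecMap (AlgHom.id ℂ A) = 𝟙 (complexSpec A) := by
  refine Over.OverMorphism.ext ?_
  exact Spec.map_id _

/-- The isomorphism of affine schemes given by an isomorphism of algebras. -/
def complexSpecIso {A B : Type u} [CommRing A] [Algebra ℂ A] [CommRing B] [Algebra ℂ B]
    (e : A ≃ₐ[ℂ] B) : complexSpec B ≅ complexSpec A where
  hom := complexSpecMap e.toAlgHom
  inv := complexSpecMap e.symm.toAlgHom
  hom_inv_id := by
    rw [complexSpecMap_comp, ← complexSpecMap_id]
    congr 1
    ext x
    exact e.apply_symm_apply x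
  inv_hom_id := by
    rw [complexSpecMap_comp, ← complexSpecMap_id]
    congr 1
    ext x
    exact e.symm_apply_apply x

theorem complexSpecMap_complexPoint {A B : Type u} [CommRing A] [Algebra ℂ A] [CommRing B]
    [Algebra ℂ B] (φ : A →ₐ[ℂ] B) (ψ : B →ₐ[ℂ] ℂ) :
    (complexSpecMap φ).left (complexPoint ψ) = complexPoint (ψ.comp φ) :=
  rfl

/-- The kernel determines `φ`, because `a - φ a` lies in it for every `a`. -/
theorem complexPoint_injective {A : Type u} [CommRing A] [Algebra ℂ A] :
    Function.Injective (complexPoint (A := A)) := by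
  intro φ ψ h
  have hker : RingHom.ker φ = RingHom.ker ψ := congrArg PrimeSpectrum.asIdeal h
  ext a
  have ha : a - algebraMap ℂ A (φ a) ∈ RingHom.ker φ := by
    rw [RingHom.mem_ker, map_sub, AlgHom.commutes, Algebra.algebraMap_self, RingHom.id_apply,
      sub_self]
  rw [hker, RingHom.mem_ker, map_sub, AlgHom.commutes, Algebra.algebraMap_self, RingHom.id_apply,
    sub_eq_zero] at ha
  exact ha.symm

/-- The points of the quotient given by two representations agree if and only if they are not
separated by invariant functions. -/
theorem repQuotientMap_repPoint_eq_iff {𝔫 : Type u} [LieRing 𝔫] [LieAlgebra ℂ 𝔫] {n : ℕ}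
    {ρ₁ ρ₂ : LieRep 𝔫 n} :
    (repQuotientMap 𝔫 n).left (repPoint ρ₁) = (repQuotientMap 𝔫 n).left (repPoint ρ₂) ↔
      ∀ f : repInvariants 𝔫 n, f.1.1 ρ₁ = f.1.1 ρ₂ := by
  rw [repQuotientMap, repPoint, repPoint]
  erw [complexSpecMap_complexPoint, complexSpecMap_complexPoint, complexPoint_injective.eq_iff]
  exact DFunLike.ext_iff

theorem repQuotientMap_repPoint_eq_iff_charpoly {𝔫 : Type u} [LieRing 𝔫] [LieAlgebra ℂ 𝔫]
    [FiniteDimensional ℂ 𝔫] [LieAlgebra.IsSolvable 𝔫] {n : ℕ} {ρ₁ ρ₂ : LieRep 𝔫 n} :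
    (repQuotientMap 𝔫 n).left (repPoint ρ₁) = (repQuotientMap 𝔫 n).left (repPoint ρ₂) ↔
      ∀ x, (ρ₁ x).charpoly = (ρ₂ x).charpoly :=
  repQuotientMap_repPoint_eq_iff.trans
    ⟨charpoly_eq_of_forall_invariant_eq, invariant_eq_of_forall_charpoly_eq⟩

/-- Simultaneous diagonal forms of the semisimple parts of two representations with the same
characteristic polynomials agree up to a permutation. -/
theorem exists_perm_of_isDiag_semisimplePart {𝔫 : Type u} [LieRing 𝔫] [LieAlgebra ℂ 𝔫]
    [LieRing.IsNilpotent 𝔫] {n : ℕ} {ρ₁ ρ₂ : LieRep 𝔫 n} {g₁ g₂ : GL (Fin n) ℂ}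
    (h₁ : ∀ x, (g₁.1 * semisimplePart (ρ₁ x) * g₁⁻¹.1).IsDiag)
    (h₂ : ∀ x, (g₂.1 * semisimplePart (ρ₂ x) * g₂⁻¹.1).IsDiag)
    (h : ∀ x, (ρ₁ x).charpoly = (ρ₂ x).charpoly) :
    ∃ σ : Equiv.Perm (Fin n), ∀ (x : 𝔫) (i : Fin n),
      (g₁.1 * semisimplePart (ρ₁ x) * g₁⁻¹.1) i i =
        (g₂.1 * semisimplePart (ρ₂ x) * g₂⁻¹.1) (σ i) (σ i) := by
  -- For an arbitrary `g`, the entries are fixed linear combinations of the weights `μ k`, hence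
  -- linear in `x`, as the permutation lemma requires.
  have hlin : ∀ (ρ : LieRep 𝔫 n) (g : GL (Fin n) ℂ), ∃ α : Fin n → 𝔫 →ₗ[ℂ] ℂ,
      ∀ x i, α i x = (g.1 * semisimplePart (ρ x) * g⁻¹.1) i i := by
    intro ρ g
    obtain ⟨u, μ, hu⟩ := exists_conj_semisimplePart_eq_diagonal ρ
    have hs : ∀ x, semisimplePart (ρ x) = u⁻¹.1 * (Matrix.diagonal fun i => μ i x) * u.1 := by
      intro x
      have h : u⁻¹.1 * u.1 = 1 := u.inv_mul
      rw [← hu]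
      calc semisimplePart (ρ x) = (u⁻¹.1 * u.1) * semisimplePart (ρ x) * (u⁻¹.1 * u.1) := by
            rw [h, one_mul, mul_one]
        _ = _ := by simp only [mul_assoc]
    let P := g.1 * u⁻¹.1
    let Q := u.1 * g⁻¹.1
    refine ⟨fun i => ∑ k, (P i k * Q k i) • μ k, fun x i => ?_⟩
    have : g.1 * semisimplePart (ρ x) * g⁻¹.1 = P * (Matrix.diagonal fun i => μ i x) * Q := by
      rw [hs]
      simp only [P, Q, mul_assoc]
    rw [this, Matrix.mul_apply, LinearMap.sum_apply]
    refine Finset.sum_congr rfl fun k _ => ?_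
    rw [Matrix.mul_diagonal, LinearMap.smul_apply, smul_eq_mul]
    ring
  obtain ⟨α, hα⟩ := hlin ρ₁ g₁
  obtain ⟨β, hβ⟩ := hlin ρ₂ g₂
  obtain ⟨σ, hσ⟩ := exists_perm_of_charpoly_diagonal_eq α β fun x => by
    have h1 : (Matrix.diagonal fun i => α i x) = g₁.1 * semisimplePart (ρ₁ x) * g₁⁻¹.1 := by
      simp only [hα]
      exact (h₁ x).diagonal_diag
    have h2 : (Matrix.diagonal fun i => β i x) = g₂.1 * semisimplePart (ρ₂ x) * g₂⁻¹.1 := by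
      simp only [hβ]
      exact (h₂ x).diagonal_diag
    rw [h1, h2, charpoly_conj, charpoly_conj, charpoly_semisimplePart, charpoly_semisimplePart, h]
  exact ⟨σ, fun x i => by rw [← hα, ← hβ, hσ]⟩

end

theorem proposition2 (𝔫 : Type u) [LieRing 𝔫] [LieAlgebra ℂ 𝔫] [FiniteDimensional ℂ 𝔫]
    [LieRing.IsNilpotent 𝔫] (n l : ℕ) (hl : l = Module.finrank ℂ (LieAbelianization 𝔫)) :
    -- the identification of the quotient with `S^n ℂ^l`, for each basis of `𝔫 / [𝔫, 𝔫]`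
    (∀ b : Module.Basis (Fin l) ℂ (LieAbelianization 𝔫),
      ∃ Φ : symProduct.{u} n l ≅ repQuotient 𝔫 n, ∀ v : Fin n → Fin l → ℂ,
        Φ.hom.left ((symProductMap n l).left (tuplePoint v)) =
          (repQuotientMap 𝔫 n).left (repPoint (diagRep b v))) ∧
    -- the fibres of the quotient map
    (∀ ρ₁ ρ₂ : LieRep 𝔫 n,
      (repQuotientMap 𝔫 n).left (repPoint ρ₁) = (repQuotientMap 𝔫 n).left (repPoint ρ₂) ↔
        ∃ g : GL (Fin n) ℂ, ∀ x : 𝔫,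
          semisimplePart (ρ₁ x) = g.1 * semisimplePart (ρ₂ x) * g⁻¹.1) ∧
    -- semisimple parts are simultaneously diagonalizable
    (∀ ρ : LieRep 𝔫 n, ∃ g : GL (Fin n) ℂ, ∀ x : 𝔫,
      (g.1 * semisimplePart (ρ x) * g⁻¹.1).IsDiag) ∧
    -- diagonal forms in the same fibre differ by a permutation of the diagonal entries
    (∀ (ρ₁ ρ₂ : LieRep 𝔫 n) (g₁ g₂ : GL (Fin n) ℂ),
      (∀ x : 𝔫, (g₁.1 * semisimplePart (ρ₁ x) * g₁⁻¹.1).IsDiag) →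
      (∀ x : 𝔫, (g₂.1 * semisimplePart (ρ₂ x) * g₂⁻¹.1).IsDiag) →
      (repQuotientMap 𝔫 n).left (repPoint ρ₁) = (repQuotientMap 𝔫 n).left (repPoint ρ₂) →
        ∃ σ : Equiv.Perm (Fin n), ∀ (x : 𝔫) (i : Fin n),
          (g₁.1 * semisimplePart (ρ₁ x) * g₁⁻¹.1) i i =
            (g₂.1 * semisimplePart (ρ₂ x) * g₂⁻¹.1) (σ i) (σ i)) := by

  have hdiag : ∀ ρ : LieRep 𝔫 n, ∃ g : GL (Fin n) ℂ, ∀ x : 𝔫,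
      (g.1 * semisimplePart (ρ x) * g⁻¹.1).IsDiag := by
    intro ρ
    obtain ⟨g, μ, h⟩ := exists_conj_semisimplePart_eq_diagonal ρ
    exact ⟨g, fun x => by rw [h]; exact Matrix.isDiag_diagonal _⟩
  refine ⟨fun b => ?_, fun ρ₁ ρ₂ => ?_, hdiag, fun ρ₁ ρ₂ g₁ g₂ h₁ h₂ h =>
    exists_perm_of_isDiag_semisimplePart h₁ h₂ (repQuotientMap_repPoint_eq_iff_charpoly.1 h)⟩
  · obtain ⟨e, he⟩ := exists_algEquiv_multisymmetric (n := n) b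
    refine ⟨complexSpecIso (e.trans ULift.algEquiv.symm), fun v => ?_⟩
    let φ := e.trans ULift.algEquiv.{0, 0, u}.symm
    let ψ : ULift.{u} (multisymmetric n l) →ₐ[ℂ] ℂ :=
      ((MvPolynomial.aeval fun q : Fin n × Fin l => v q.1 q.2).comp (multisymmetric n l).val).comp
        ULift.algEquiv.toAlgHom
    let E := ((Pi.evalAlgHom ℂ (fun _ : LieRep 𝔫 n => ℂ) (diagRep b v)).comp
      (repFunctions 𝔫 n).val).comp (repInvariants 𝔫 n).val
    -- On `ℂ`-points the isomorphism is precomposition with `φ`, so the claim reduces to `he` for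
    -- evaluation at `v`.
    have h : ψ.comp φ.toAlgHom = E := AlgHom.ext fun f => he f v
    exact congrArg (complexPoint (A := repInvariants 𝔫 n)) h
  · rw [repQuotientMap_repPoint_eq_iff_charpoly]
    constructor
    · intro h
      obtain ⟨g₁, h₁⟩ := hdiag ρ₁
      obtain ⟨g₂, h₂⟩ := hdiag ρ₂
      obtain ⟨σ, hσ⟩ := exists_perm_of_isDiag_semisimplePart h₁ h₂ h
      obtain ⟨u, hu⟩ := exists_conj_apply_eq_perm σ
      -- Diagonalize `ρ₂` by `g₂`, match the diagonal entries by the permutation matrix `u`, and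
      -- undo `g₁`.
      refine ⟨g₁⁻¹ * (u * g₂), fun x => ?_⟩
      have key : g₁.1 * semisimplePart (ρ₁ x) * g₁⁻¹.1 =
          u.1 * (g₂.1 * semisimplePart (ρ₂ x) * g₂⁻¹.1) * u⁻¹.1 := by
        ext i j
        rw [hu]
        by_cases hij : i = j
        · subst hij
          exact hσ x i
        · rw [h₁ x hij, h₂ x (σ.injective.ne hij)]
      have h1 : g₁⁻¹.1 * g₁.1 = 1 := g₁.inv_mul
      calc semisimplePart (ρ₁ x)
          = g₁⁻¹.1 * (g₁.1 * semisimplePart (ρ₁ x) * g₁⁻¹.1) * g₁.1 := by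
            rw [mul_assoc g₁.1, ← mul_assoc, h1, one_mul, mul_assoc, h1, mul_one]
        _ = _ := by
            rw [key, mul_inv_rev, mul_inv_rev, inv_inv]
            simp only [Units.val_mul, mul_assoc]
    · rintro ⟨g, hg⟩ x
      rw [← charpoly_semisimplePart (ρ₁ x), ← charpoly_semisimplePart (ρ₂ x), hg, charpoly_conj]
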